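/- **Theorem 3.4.** Let $n\ge 3$, let $l_1,\dots,l_n>0$, and let $\mathcal M(L)$ be the set of configurations of the linkage $L=(l_1,\dots,l_n)$, i.e. of all $P=(p_1,\dots,p_n)\in(\mathbb R^2)^n$ with $|p_ip_{i+1}|=l_i$ for all $i$ (indices modulo $n$), pinned by $p_1=(0,0)$ and $p_2=(0,l_1)$. Let $A(P)=\frac12\sum_{i=1}^n (x_iy_{i+1}-x_{i+1}y_i)$, where $p_i=(x_i,y_i)$, be the signed area. Let $P\in\mathcal M(L)$ be a cyclic configuration, all of whose vertices lie on a circle with center $O$, and assume that $P$ is generic in the following sense: no edge $p_ip_{i+1}$ passes through $O$, and the vertices of $P$ do not all lie on one line. Let $\varepsilon_i=1$ if $O$ lies to the left of the oriented edge $p_ip_{i+1}$ and $\varepsilon_i=-1$ if it lies to the right, let $\alpha_i$ be half of the unoriented angle between $\overrightarrow{Op_i}$ and $\overrightarrow{Op_{i+1}}$, and put $$\delta(P)=\sum_{i=1}^n\varepsilon_i\tan\alpha_i,\qquad d(P)=\operatorname{sign}\delta(P)\in\{-1,0,1\},\qquad e(P)=\#\{i:\varepsilon_i=1\}.$$ Then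 $\mathcal M(L)$ is a smooth $(n-3)$-dimensional submanifold of $(\mathbb R^2)^n$ near $P$, and the sign $\mathcal H(P)$ of the determinant of the Hessian of $A|_{\mathcal M(L)}$ at $P$, computed in any smooth local parametrization of $\mathcal M(L)$ by $\mathbb R^{n-3}$ around $P$, is $$\mathcal H(P)=-\,d(P)\,(-1)^{e(P)}.$$ (For $n=3$ the determinant of the empty matrix is $1$.) -/

import Mathlib

open scoped ContDiff

noncomputable section

namespace PolygonalLinkage

/-- The Euclidean plane `ℝ²`. -/
abbrev Plane : Type := EuclideanSpace ℝ (Fin 2)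

/-- The moduli space `M(L)` of the linkage with edge lengths `l 0, …, l (n-1)`: all closed polygons
`p 0, …, p (n-1)` (indices modulo `n`) with `|p i p (i+1)| = l i` whose first two vertices are
pinned at `(0, 0)` and `(0, l 0)`. As the first two vertices are constant, this is the same space as
its image in `ℝ^(2(n-2))`. -/
def moduliSpace {n : ℕ} [NeZero n] (l : Fin n → ℝ) : Set (Fin n → Plane) :=
  {p | (∀ i, dist (p i) (p (i + 1)) = l i) ∧ p 0 = 0 ∧ p 1 = !₂[0, l 0]}

/-- The determinant of two plane vectors. It is positive iff `w` points to the left of `v`. -/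
def cross (v w : Plane) : ℝ := v 0 * w 1 - v 1 * w 0

/-- The signed area `A(p)` of a closed polygon. -/
def signedArea {n : ℕ} [NeZero n] (p : Fin n → Plane) : ℝ :=
  (∑ i, cross (p i) (p (i + 1))) / 2

/-- All vertices of `p` lie on the circle with center `O` and radius `r`. -/
def IsInscribed {n : ℕ} (p : Fin n → Plane) (O : Plane) (r : ℝ) : Prop :=
  ∀ i, dist (p i) O = r

/-- One of the edges passes through the center `O`. -/
def IsCentral {n : ℕ} [NeZero n] (p : Fin n → Plane) (O : Plane) : Prop :=
  ∃ i, O ∈ segment ℝ (p i) (p (i + 1))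

/-- `ε i`: it is `1` if `O` lies to the left of the directed edge from `p i` to `p (i+1)`, and `-1` if
`O` lies to the right of it (for a non-central configuration these are the only cases). -/
def orient {n : ℕ} [NeZero n] (p : Fin n → Plane) (O : Plane) (i : Fin n) : SignType :=
  SignType.sign (cross (p (i + 1) - p i) (O - p i))

/-- `α i`: half of the unoriented angle between the vectors from `O` to `p i` and to `p (i+1)`. -/
def halfAngle {n : ℕ} [NeZero n] (p : Fin n → Plane) (O : Plane) (i : Fin n) : ℝ :=
  InnerProductGeometry.angle (p i - O) (p (i + 1) - O) / 2

/-- `δ = ∑ ε i * tan (α i)`. -/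
def delta {n : ℕ} [NeZero n] (p : Fin n → Plane) (O : Plane) : ℝ :=
  ∑ i, (orient p O i : ℝ) * Real.tan (halfAngle p O i)

/-- `e`: the number of edges with `ε i = 1`. -/
def numPositive {n : ℕ} [NeZero n] (p : Fin n → Plane) (O : Plane) : ℕ :=
  (Finset.univ.filter fun i => orient p O i = 1).card

/-- `φ`, restricted to the open set `U ⊆ ℝ^k`, is a smooth local parametrization of the set `M` around
`P = φ u`: a smooth immersion that is a homeomorphism from `U` onto a relatively open subset of
`M`. -/
structure IsLocalParametrization {E : Type*} [NormedAddCommGroup E] [NormedSpace ℝ E] {k : ℕ}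
    (M : Set E) (P : E) (U : Set (Fin k → ℝ)) (φ : (Fin k → ℝ) → E) (u : Fin k → ℝ) : Prop where
  isOpen : IsOpen U
  mem : u ∈ U
  map_eq : φ u = P
  contDiffOn : ContDiffOn ℝ ∞ φ U
  injective_fderiv : ∀ v ∈ U, Function.Injective (fderiv ℝ φ v)
  isEmbedding : Topology.IsEmbedding (U.domRestrict φ)
  image_eq : ∃ W : Set E, IsOpen W ∧ φ '' U = M ∩ W

/-- The matrix of second partial derivatives of `f` at `u`. -/
def hessianMatrix {k : ℕ} (f : (Fin k → ℝ) → ℝ) (u : Fin k → ℝ) : Matrix (Fin k) (Fin k) ℝ :=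
  Matrix.of fun i j =>
    fderiv ℝ (fun v => fderiv ℝ f v (Pi.single j 1)) u (Pi.single i 1)

end PolygonalLinkage

end

/-!
Put the center of the circle at the origin and write `q k` for the vertices, `X k` for the cross
product and `S k` for the inner product of `q k` and `q (k + 1)`. Non-centrality makes every `X k`
nonzero, and `t k = (r² - S k) / X k` is `ε k * tan (α k)`, with inverse `c k = (r² + S k) / X k`.

The signed area and the squared edge lengths are quadratic forms. The Lagrangian
`Φ(p) = A(p) - ∑ c k / 4 * |p (k + 1) - p k|²` has `P` as a critical point
(`lagrangianForm_eq_zero`), so the Hessian of the area in a local parametrization is the polar form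
of `2 Φ` on the tangent space (`fderiv_fderiv_comp_quadratic`). A tangent vector `w` preserves the
edge lengths to first order and vanishes at the two pinned vertices, and it is determined by its
radial components `a k = ⟪q k, w k⟫`, because its tangential components `b k` satisfy
`b (k + 1) - b k = - t k * (a k + a (k + 1))`. In these coordinates
`4 r² Φ(w) = T(a, a) = ∑ (t k * (a k + a (k + 1))² - c k * (a k - a (k + 1))²)`
(`sq_mul_lagrangianForm`), a cyclic tridiagonal form `edgeForm`.

Three facts about `T` determine the sign. The sequences `k ↦ cross s (q k)`, which come from the
translations of the plane, lie in its kernel (`edgeOp_cross`). The tangent space is the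
`T`-orthogonal complement of the constant sequence `1` in the space of sequences vanishing at the
two pinned vertices; here `1` is corrected by a kernel element so as to vanish there too
(`chordDefect`), and the corrected sequence is nonzero because the vertices are not collinear.
Finally `T(1, 1) = 4 δ`. Hence the sign of the Hessian determinant is `sign δ` times the sign of the
determinant of the tridiagonal matrix of `T` on all sequences vanishing at the pinned vertices
(`sign_det_transpose_mul_mul`). That determinant is computed by multiplying with the triangular
matrix of truncated kernel elements (`det_reducedMatrix`), and its sign is
`(-1)^(n - 3) * ∏ sign (X k) = -(-1)^e`.

The same description shows that the tangent space has dimension at most `n - 3`, so that the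
constraints are independent at `P`, and the inverse function theorem gives a local parametrization.
-/

noncomputable section

namespace PolygonalLinkage

/-! ### The sign of a determinant on an orthogonal complement -/

/-- The square matrix `C = [B | v]` block-triangularizes `M`: the congruence `Cᵀ M C` has diagonal
blocks `Bᵀ M B` and `v ⬝ᵥ M v`. If `C` is singular then both sides vanish. -/
theorem sign_det_transpose_mul_mul_aux {κ : Type*} [Fintype κ] [DecidableEq κ]
    (M : Matrix (κ ⊕ Unit) (κ ⊕ Unit) ℝ) (hM : M.det ≠ 0) (B : Matrix (κ ⊕ Unit) κ ℝ)
    (hB : ∀ x, B.mulVec x = 0 → x = 0) (v : κ ⊕ Unit → ℝ) (hv : v ≠ 0)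
    (hBv : B.transpose.mulVec (M.mulVec v) = 0) :
    SignType.sign (B.transpose * M * B).det
      = SignType.sign M.det * SignType.sign (v ⬝ᵥ M.mulVec v) := by
  let C : Matrix (κ ⊕ Unit) (κ ⊕ Unit) ℝ := Matrix.fromCols B (Matrix.replicateCol Unit v)
  have hBv' : B.transpose * M * Matrix.replicateCol Unit v = 0 := by
    ext i j
    have := congrFun hBv i
    rw [Matrix.mulVec_mulVec] at this
    simpa [Matrix.mul_apply, Matrix.mulVec, dotProduct] using this
  have hblock : C.transpose * M * C = Matrix.fromBlocks (B.transpose * M * B) 0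
      ((Matrix.replicateCol Unit v).transpose * M * B)
      ((Matrix.replicateCol Unit v).transpose * M * Matrix.replicateCol Unit v) := by
    simp only [C, Matrix.transpose_fromCols]
    rw [Matrix.fromRows_mul, Matrix.fromRows_mul_fromCols, hBv']
  have hcorner : ((Matrix.replicateCol Unit v).transpose * M * Matrix.replicateCol Unit v).det
      = v ⬝ᵥ M.mulVec v := by
    rw [Matrix.det_unique, Matrix.mul_assoc]
    simp [Matrix.mul_apply, Matrix.mulVec, dotProduct]
  have hdet : C.det ^ 2 * M.det = (B.transpose * M * B).det * (v ⬝ᵥ M.mulVec v) := by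
    rw [← hcorner, ← Matrix.det_fromBlocks_zero₁₂, ← hblock, Matrix.det_mul, Matrix.det_mul,
      Matrix.det_transpose]
    ring
  by_cases hC : C.det = 0
  · obtain ⟨y, hy0, hy⟩ := Matrix.exists_mulVec_eq_zero_iff.2 hC
    have hy' : B.mulVec (y ∘ Sum.inl) + y (Sum.inr ()) • v = 0 := by
      have := hy
      simp only [C, Matrix.fromCols_mulVec] at this
      rw [← this]
      congr 1
      ext i
      simp [Matrix.mulVec, dotProduct, mul_comm]
    have hs : y (Sum.inr ()) ≠ 0 := by
      intro hs
      rw [hs, zero_smul, add_zero] at hy'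
      have := hB _ hy'
      apply hy0
      ext i
      rcases i with i | i
      · exact congrFun this i
      · exact hs
    have hx : y ∘ Sum.inl ≠ 0 := by
      intro hx
      rw [hx, Matrix.mulVec_zero, zero_add] at hy'
      exact (smul_ne_zero hs hv) hy'
    have h1 : (B.transpose * M * B).det = 0 := by
      refine Matrix.exists_mulVec_eq_zero_iff.1 ⟨_, hx, ?_⟩
      rw [← Matrix.mulVec_mulVec, eq_neg_of_add_eq_zero_left hy', Matrix.mulVec_neg,
        Matrix.mulVec_smul, ← Matrix.mulVec_mulVec, hBv, smul_zero, neg_zero]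
    have h2 : v ⬝ᵥ M.mulVec v = 0 := by
      have h3 := congrArg (fun z => z ⬝ᵥ M.mulVec v) hy'
      simp only [add_dotProduct, smul_dotProduct, zero_dotProduct] at h3
      rw [← Matrix.vecMul_transpose, ← Matrix.dotProduct_mulVec, hBv, dotProduct_zero,
        zero_add, smul_eq_mul] at h3
      exact (mul_eq_zero.1 h3).resolve_left hs
    simp [h1, h2]
  · have hs := congrArg SignType.sign hdet
    rw [sign_mul, sign_mul, sign_pos (by positivity : 0 < C.det ^ 2), one_mul] at hs
    have hM' : SignType.sign M.det ≠ 0 := sign_ne_zero.2 hM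
    revert hs hM'
    generalize SignType.sign M.det = s1
    generalize SignType.sign (B.transpose * M * B).det = s2
    generalize SignType.sign (v ⬝ᵥ M.mulVec v) = s3
    revert s1 s2 s3
    decide

/-- If the columns of `B` are a basis of the `M`-orthogonal complement of `v ≠ 0`, the restriction of
`M` to this complement has determinant of sign `sign (det M) * sign (v ⬝ᵥ M v)`. This includes the
case of an `M`-isotropic `v`, in which the restriction is singular. -/
theorem sign_det_transpose_mul_mul {k : ℕ} (M : Matrix (Fin (k + 1)) (Fin (k + 1)) ℝ)
    (hM : M.det ≠ 0) (B : Matrix (Fin (k + 1)) (Fin k) ℝ)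
    (hB : ∀ x, B.mulVec x = 0 → x = 0) (v : Fin (k + 1) → ℝ) (hv : v ≠ 0)
    (hBv : B.transpose.mulVec (M.mulVec v) = 0) :
    SignType.sign (B.transpose * M * B).det
      = SignType.sign M.det * SignType.sign (v ⬝ᵥ M.mulVec v) := by
  obtain ⟨e⟩ : Nonempty (Fin k ⊕ Unit ≃ Fin (k + 1)) :=
    Fintype.card_eq.1 (by simp)
  have h := sign_det_transpose_mul_mul_aux (M.submatrix e e) (by simpa using hM)
    (B.submatrix e id) (fun x hx => hB x ?_) (v ∘ e) ?_ ?_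
  · have h1 : (B.submatrix e id).transpose * M.submatrix e e * B.submatrix e id
        = B.transpose * M * B := by
      rw [Matrix.transpose_submatrix, Matrix.submatrix_mul_equiv, Matrix.submatrix_mul_equiv,
        Matrix.submatrix_id_id]
    rw [h1, Matrix.det_submatrix_equiv_self, Matrix.submatrix_mulVec_equiv, Function.comp_assoc,
      Equiv.self_comp_symm, Function.comp_id, comp_equiv_dotProduct_comp_equiv] at h
    exact h
  · ext i
    have := congrFun hx (e.symm i)
    simpa [Matrix.mulVec, dotProduct] using this
  · intro h0
    exact hv (funext fun i => by simpa using congrFun h0 (e.symm i))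
  · rw [Matrix.transpose_submatrix, Matrix.submatrix_mulVec_equiv, Matrix.submatrix_mulVec_equiv]
    simp only [Function.comp_assoc, Equiv.self_comp_symm, Function.comp_id]
    rw [hBv]

/-! ### Smooth parametrization of a regular level set -/

/-- Near a regular point, a level set of a smooth map has a local parametrization: complete `G` by a
projection onto the kernel of its derivative to a local diffeomorphism, and restrict its inverse. -/
theorem exists_isLocalParametrization_levelSet {E F : Type*} [NormedAddCommGroup E]
    [NormedSpace ℝ E] [FiniteDimensional ℝ E] [NormedAddCommGroup F] [NormedSpace ℝ F]
    [FiniteDimensional ℝ F] {G : E → F} (hG : ContDiff ℝ ∞ G) (P : E) {k : ℕ}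
    (hsurj : Function.Surjective (fderiv ℝ G P))
    (hker : Module.finrank ℝ (fderiv ℝ G P).ker = k) :
    ∃ (U : Set (Fin k → ℝ)) (φ : (Fin k → ℝ) → E) (u : Fin k → ℝ),
      IsLocalParametrization {x | G x = G P} P U φ u := by
  have : CompleteSpace E := FiniteDimensional.complete ℝ E
  have : CompleteSpace F := FiniteDimensional.complete ℝ F
  set K := (fderiv ℝ G P).ker with hK
  let e : K ≃L[ℝ] (Fin k → ℝ) := ContinuousLinearEquiv.ofFinrankEq (by simp [hker])
  obtain ⟨π₀, hπ₀⟩ := K.subtypeL.toLinearMap.exists_leftInverse_of_injective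
    (LinearMap.ker_eq_bot.2 K.injective_subtype)
  let π : E →L[ℝ] (Fin k → ℝ) := (e : K →L[ℝ] (Fin k → ℝ)).comp (LinearMap.toContinuousLinearMap π₀)
  have hπK : ∀ x : K, π x = e x := fun x => by
    have := LinearMap.congr_fun hπ₀ x
    simp only [LinearMap.comp_apply, LinearMap.id_apply] at this
    simpa [π] using this
  let H : E → (Fin k → ℝ) × F := fun x => (π x, G x)
  have hH : ContDiff ℝ ∞ H := π.contDiff.prodMk hG
  have hHd : HasFDerivAt H (π.prod (fderiv ℝ G P)) P :=
    π.hasFDerivAt.prodMk (hG.differentiable (by simp) P).hasFDerivAt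
  have hbij : Function.Bijective (π.prod (fderiv ℝ G P)) := by
    constructor
    · rw [injective_iff_map_eq_zero]
      intro x hx
      have hx2 : x ∈ K := (Prod.ext_iff.1 hx).2
      have hx1 : π x = 0 := (Prod.ext_iff.1 hx).1
      have := hπK ⟨x, hx2⟩
      rw [hx1] at this
      simpa using (map_eq_zero_iff e e.injective).1 this.symm
    · rintro ⟨y, z⟩
      obtain ⟨x, rfl⟩ := hsurj z
      refine ⟨x + (e.symm (y - π x) : K), ?_⟩
      simp [hπK]
  let D : E ≃L[ℝ] (Fin k → ℝ) × F :=
    (LinearEquiv.ofBijective (π.prod (fderiv ℝ G P)).toLinearMap hbij).toContinuousLinearEquiv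
  have hD : (D : E →L[ℝ] (Fin k → ℝ) × F) = π.prod (fderiv ℝ G P) := by
    ext x <;> rfl
  have hHD : HasFDerivAt H (D : E →L[ℝ] (Fin k → ℝ) × F) P := hD ▸ hHd
  -- on `S` the derivative of `H` stays invertible, so the local inverse is smooth on a whole
  -- neighborhood and not only at `H P`
  let S : Set E := fderiv ℝ H ⁻¹' Set.range ((↑) : (E ≃L[ℝ] (Fin k → ℝ) × F) → _)
  have hS : IsOpen S := (ContinuousLinearEquiv.isOpen).preimage (hH.continuous_fderiv (by simp))
  have hPS : P ∈ S := ⟨D, hHD.fderiv.symm⟩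
  let h₀ := hH.contDiffAt.toOpenPartialHomeomorph H hHD (by simp)
  let h := h₀.restrOpen S hS
  have hh : ∀ x, h x = H x := fun x => rfl
  have hPh : P ∈ h.source :=
    ⟨hH.contDiffAt.mem_toOpenPartialHomeomorph_source hHD (by simp), hPS⟩
  have hsymm : ∀ y ∈ h.target, ContDiffAt ℝ ∞ h.symm y := fun y hy => by
    have hy' : h.symm y ∈ h.source := h.map_target hy
    obtain ⟨D', hD'⟩ : h.symm y ∈ S := hy'.2
    refine h.contDiffAt_symm hy (f₀' := D') ?_ hH.contDiffAt
    rw [hD']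
    exact (hH.differentiable (by simp) _).hasFDerivAt
  let ι : (Fin k → ℝ) → (Fin k → ℝ) × F := fun v => (v, G P)
  have hι : ContDiff ℝ ∞ ι := contDiff_id.prodMk contDiff_const
  -- `π` is a left inverse of the slice `φ` of the inverse of `H`; immersivity and the embedding
  -- property both come from this
  let U : Set (Fin k → ℝ) := ι ⁻¹' h.target
  let φ : (Fin k → ℝ) → E := fun v => h.symm (ι v)
  have hUo : IsOpen U := h.open_target.preimage hι.continuous
  have hφ : ContDiffOn ℝ ∞ φ U := fun v hv =>
    ((hsymm _ hv).comp v hι.contDiffAt).contDiffWithinAt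
  have hright : ∀ v ∈ U, H (φ v) = ι v := fun v hv => h.right_inv hv
  have hleft : ∀ v ∈ U, π (φ v) = v := fun v hv => congrArg Prod.fst (hright v hv)
  refine ⟨U, φ, π P, hUo, h.map_source hPh, h.left_inv hPh, hφ, fun v hv => ?_, ?_, h.source,
    h.open_source, ?_⟩
  · have hd : DifferentiableAt ℝ φ v :=
      (hφ.contDiffAt (hUo.mem_nhds hv)).differentiableAt (by simp)
    have h1 : HasFDerivAt (fun v => π (φ v)) (π.comp (fderiv ℝ φ v)) v :=
      π.hasFDerivAt.comp v hd.hasFDerivAt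
    have h2 : HasFDerivAt (fun v => π (φ v)) (ContinuousLinearMap.id ℝ (Fin k → ℝ)) v :=
      (hasFDerivAt_id v).congr_of_eventuallyEq
        (Filter.eventually_of_mem (hUo.mem_nhds hv) hleft)
    have h3 := h1.unique h2
    exact Function.LeftInverse.injective (g := π) fun x => congrArg (fun T => T x) h3
  · refine Topology.IsEmbedding.of_comp (g := π) hφ.continuousOn.domRestrict π.continuous ?_
    convert Topology.IsEmbedding.subtypeVal (p := (· ∈ U)) using 1
    ext1 v
    exact hleft v v.2
  · ext x
    constructor
    · rintro ⟨v, hv, rfl⟩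
      exact ⟨congrArg Prod.snd (hright v hv), h.map_target hv⟩
    · rintro ⟨hx, hxs⟩
      have hx1 : ι (π x) = h x := Prod.ext rfl (Eq.symm hx)
      refine ⟨π x, ?_, ?_⟩
      · change ι (π x) ∈ h.target
        rw [hx1]; exact h.map_source hxs
      · change h.symm (ι (π x)) = x
        rw [hx1]; exact h.left_inv hxs

/-! ### The cyclic tridiagonal form -/

/-- The symmetric bilinear form `T(a, b)` on cyclic sequences with one term
`t (a + a')(b + b') - c (a - a')(b - b')` for each edge. -/
def edgeForm {n : ℕ} [NeZero n] (t c a b : Fin n → ℝ) : ℝ :=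
  ∑ k, (t k * (a k + a (k + 1)) * (b k + b (k + 1)) - c k * (a k - a (k + 1)) * (b k - b (k + 1)))

/-- The cyclic tridiagonal operator representing `edgeForm` with respect to the standard inner product,
see `edgeForm_eq_sum`. -/
def edgeOp {n : ℕ} [NeZero n] (t c : Fin n → ℝ) : (Fin n → ℝ) →ₗ[ℝ] (Fin n → ℝ) where
  toFun a k := (t k + c k) * a (k + 1) + (t (k - 1) + c (k - 1)) * a (k - 1)
    + (t k - c k + (t (k - 1) - c (k - 1))) * a k
  map_add' a b := by ext k; simp only [Pi.add_apply]; ring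
  map_smul' s a := by ext k; simp only [Pi.smul_apply, smul_eq_mul, RingHom.id_apply]; ring

theorem edgeOp_apply {n : ℕ} [NeZero n] (t c a : Fin n → ℝ) (k : Fin n) :
    edgeOp t c a k = (t k + c k) * a (k + 1) + (t (k - 1) + c (k - 1)) * a (k - 1)
    + (t k - c k + (t (k - 1) - c (k - 1))) * a k := rfl

theorem sum_add_one {n : ℕ} [NeZero n] (f : Fin n → ℝ) : ∑ k, f (k + 1) = ∑ k, f k :=
  Equiv.sum_comp (Equiv.addRight (1 : Fin n)) f

theorem edgeForm_eq_sum {n : ℕ} [NeZero n] (t c a b : Fin n → ℝ) :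
    edgeForm t c a b = ∑ k, b k * edgeOp t c a k := by
  have h := sum_add_one fun k => b k * (t (k - 1) * (a (k - 1) + a k) + c (k - 1) * (a (k - 1) - a k))
  simp only [add_sub_cancel_right] at h
  have h2 : ∀ k, b k * edgeOp t c a k =
      b k * (t k * (a k + a (k + 1)) - c k * (a k - a (k + 1))) +
      b k * (t (k - 1) * (a (k - 1) + a k) + c (k - 1) * (a (k - 1) - a k)) := by
    intro k; rw [edgeOp_apply]; ring
  simp only [h2]
  rw [Finset.sum_add_distrib, ← h, ← Finset.sum_add_distrib]
  refine Finset.sum_congr rfl fun k _ => ?_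
  ring

theorem edgeForm_comm {n : ℕ} [NeZero n] (t c a b : Fin n → ℝ) :
    edgeForm t c a b = edgeForm t c b a := by
  refine Finset.sum_congr rfl fun k _ => ?_
  ring

theorem inner_eq (v w : Plane) : inner ℝ v w = v 0 * w 0 + v 1 * w 1 := by
  simp [PiLp.inner_apply, Fin.sum_univ_two, mul_comm]

/-- The signed tangent `ε k * tan (α k)` of the half angle under which the edge `k` of a polygon
inscribed in the circle of radius `r` around the origin is seen, written without angles. -/
def edgeTan {n : ℕ} [NeZero n] (q : Fin n → Plane) (r : ℝ) (k : Fin n) : ℝ :=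
  (r ^ 2 - inner ℝ (q k) (q (k + 1))) / cross (q k) (q (k + 1))

/-- The inverse of `edgeTan`; a quarter of it is the Lagrange multiplier of the edge `k`. -/
def edgeCot {n : ℕ} [NeZero n] (q : Fin n → Plane) (r : ℝ) (k : Fin n) : ℝ :=
  (r ^ 2 + inner ℝ (q k) (q (k + 1))) / cross (q k) (q (k + 1))

theorem edgeTan_add_edgeCot {n : ℕ} [NeZero n] (q : Fin n → Plane) (r : ℝ) (k : Fin n) :
    edgeTan q r k + edgeCot q r k = 2 * r ^ 2 / cross (q k) (q (k + 1)) := by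
  rw [edgeTan, edgeCot]; ring

theorem edgeTan_sub_edgeCot {n : ℕ} [NeZero n] (q : Fin n → Plane) (r : ℝ) (k : Fin n) :
    edgeTan q r k - edgeCot q r k =
      -2 * inner ℝ (q k) (q (k + 1)) / cross (q k) (q (k + 1)) := by
  rw [edgeTan, edgeCot]; ring

/-- The linear functionals of the vertices are in the kernel of the tridiagonal operator, since
`r² q (k + 1) - S k • q k` and `r² q (k - 1) - S (k - 1) • q k` are the multiples of the rotated
vector `J (q k)` by `X k` and by `-X (k - 1)`. -/
theorem edgeOp_cross {n : ℕ} [NeZero n] {q : Fin n → Plane} {r : ℝ}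
    (hq : ∀ k, inner ℝ (q k) (q k) = r ^ 2) (hX : ∀ k, cross (q k) (q (k + 1)) ≠ 0) (s : Plane) :
    edgeOp (edgeTan q r) (edgeCot q r) (fun k => cross s (q k)) = 0 := by
  have key : ∀ u v : Plane, inner ℝ u u * cross s v - inner ℝ u v * cross s u
      = cross u v * inner ℝ s u := by
    intro u v; simp only [inner_eq, cross]; ring
  ext k
  obtain ⟨j, rfl⟩ : ∃ j, j + 1 = k := ⟨k - 1, sub_add_cancel k 1⟩
  have h1 := key (q (j + 1)) (q (j + 1 + 1))
  have h2 := key (q (j + 1)) (q j)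
  have h3 : inner ℝ (q (j + 1)) (q j) = inner ℝ (q j) (q (j + 1)) := real_inner_comm _ _
  have h4 : cross (q (j + 1)) (q j) = - cross (q j) (q (j + 1)) := by
    simp only [cross]; ring
  rw [hq, h3, h4] at h2
  rw [hq] at h1
  rw [edgeOp_apply, add_sub_cancel_right, edgeTan_add_edgeCot, edgeTan_add_edgeCot,
    edgeTan_sub_edgeCot, edgeTan_sub_edgeCot, Pi.zero_apply]
  have hx := hX j
  have hx' := hX (j + 1)
  field_simp
  linear_combination 2 * cross (q j) (q (j + 1)) * h1
    + 2 * cross (q (j + 1)) (q (j + 1 + 1)) * h2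

theorem edgeForm_one_right {n : ℕ} [NeZero n] (t c a : Fin n → ℝ) :
    edgeForm t c a 1 = 2 * ∑ k, t k * (a k + a (k + 1)) := by
  rw [edgeForm, Finset.mul_sum]
  refine Finset.sum_congr rfl fun k _ => ?_
  simp only [Pi.one_apply]; ring

/-- The sequence on all vertices that vanishes at the pinned vertices `0` and `1` and is `v` on the
others. -/
def extendByZero {m : ℕ} (v : Fin (m + 1) → ℝ) : Fin (m + 3) → ℝ :=
  Fin.cons 0 (Fin.cons 0 v : Fin (m + 2) → ℝ)

@[simp] theorem extendByZero_zero {m : ℕ} (v : Fin (m + 1) → ℝ) : extendByZero v 0 = 0 := rfl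

@[simp] theorem extendByZero_one {m : ℕ} (v : Fin (m + 1) → ℝ) : extendByZero v 1 = 0 := rfl

@[simp] theorem extendByZero_succ_succ {m : ℕ} (v : Fin (m + 1) → ℝ) (i : Fin (m + 1)) :
    extendByZero v i.succ.succ = v i := rfl

theorem eq_extendByZero {m : ℕ} {a : Fin (m + 3) → ℝ} (h0 : a 0 = 0) (h1 : a 1 = 0) :
    a = extendByZero fun i => a i.succ.succ := by
  ext k
  refine Fin.cases h0 (fun k => ?_) k
  refine Fin.cases h1 (fun k => rfl) k

/-- The matrix of `edgeForm` on the sequences that vanish at the vertices `0` and `1`. -/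
def reducedMatrix {m : ℕ} (t c : Fin (m + 3) → ℝ) : Matrix (Fin (m + 1)) (Fin (m + 1)) ℝ :=
  LinearMap.toMatrix'
    { toFun := fun v i => edgeOp t c (extendByZero v) i.succ.succ
      map_add' := fun v w => by
        have : extendByZero (v + w) = extendByZero v + extendByZero w := by
          rw [eq_comm]; apply eq_extendByZero <;> simp
        rw [this, map_add]; rfl
      map_smul' := fun s v => by
        have : extendByZero (s • v) = s • extendByZero v := by
          rw [eq_comm]; apply eq_extendByZero <;> simp
        rw [this, map_smul]; rfl }

theorem reducedMatrix_mulVec {m : ℕ} (t c : Fin (m + 3) → ℝ) (v : Fin (m + 1) → ℝ)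
    (i : Fin (m + 1)) :
    (reducedMatrix t c).mulVec v i = edgeOp t c (extendByZero v) i.succ.succ := by
  rw [reducedMatrix, LinearMap.toMatrix'_mulVec]; rfl

theorem sum_extendByZero_mul {m : ℕ} (v : Fin (m + 1) → ℝ) (a : Fin (m + 3) → ℝ) :
    ∑ k, extendByZero v k * a k = ∑ i, v i * a i.succ.succ := by
  rw [Fin.sum_univ_succ, Fin.sum_univ_succ, extendByZero_zero]
  simp only [extendByZero_succ_succ]
  simp

theorem dotProduct_reducedMatrix_mulVec {m : ℕ} (t c : Fin (m + 3) → ℝ)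
    (v w : Fin (m + 1) → ℝ) :
    v ⬝ᵥ (reducedMatrix t c).mulVec w = edgeForm t c (extendByZero w) (extendByZero v) := by
  rw [edgeForm_eq_sum, sum_extendByZero_mul]
  simp only [dotProduct, reducedMatrix_mulVec]

/-- The tridiagonal determinant. Multiplying by the lower triangular matrix `K` of truncated kernel
sequences leaves `2 r²` on the superdiagonal and zeros elsewhere, except in the last row, where the
cyclic closure of the polygon enters. -/
theorem det_reducedMatrix {m : ℕ} {q : Fin (m + 3) → Plane} {r : ℝ}
    (hq : ∀ k, inner ℝ (q k) (q k) = r ^ 2) (hX : ∀ k, cross (q k) (q (k + 1)) ≠ 0) :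
    (reducedMatrix (edgeTan q r) (edgeCot q r)).det
        * ∏ i : Fin (m + 1), cross (q i.castSucc.succ) (q i.succ.succ)
      = (-1) ^ m * (2 * r ^ 2) ^ (m + 1)
        * (cross (q 0) (q 1) / cross (q (Fin.last (m + 2))) (q 0)) := by
  set M := reducedMatrix (edgeTan q r) (edgeCot q r) with hM
  let K : Matrix (Fin (m + 1)) (Fin (m + 1)) ℝ :=
    Matrix.of fun i j => if j ≤ i then cross (q j.castSucc.succ) (q i.succ.succ) else 0
  have hKdet : K.det = ∏ i : Fin (m + 1), cross (q i.castSucc.succ) (q i.succ.succ) := by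
    rw [Matrix.det_of_isLowerTriangular K fun i j hij => if_neg (not_le.2 hij)]
    simp [K]
  have hself : ∀ v : Plane, cross v v = 0 := fun v => by simp only [cross]; ring
  -- the columns of `K` are truncations of the sinusoids `cross (q (j + 1)) (q k)`
  have hext : ∀ (j : Fin (m + 1)) (k : Fin (m + 3)),
      extendByZero (fun i => K i j) k =
        if j.val + 1 ≤ k.val then cross (q j.castSucc.succ) (q k) else 0 := by
    intro j k
    refine Fin.cases (by simp) (fun k => ?_) k
    refine Fin.cases ?_ (fun i => ?_) k
    · split_ifs with h
      · obtain rfl : j = 0 := Fin.ext (by simpa using h)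
        exact (hself _).symm
      · rfl
    · rw [extendByZero_succ_succ]
      change (if j ≤ i then _ else _) = _
      by_cases hji : j ≤ i
      · rw [if_pos hji, if_pos (by have := Fin.le_def.1 hji; simp; omega)]
      · rw [if_neg hji]
        split_ifs with h
        · have h1 : j.castSucc.succ = i.succ.succ := by
            rw [Fin.le_def] at hji
            ext; simp at h ⊢; omega
          rw [h1, hself]
        · rfl
  have hzero : ∀ (j : Fin (m + 1)) (k : Fin (m + 3)),
      (edgeTan q r k + edgeCot q r k) * cross (q j.castSucc.succ) (q (k + 1))
        + (edgeTan q r (k - 1) + edgeCot q r (k - 1)) * cross (q j.castSucc.succ) (q (k - 1))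
        + (edgeTan q r k - edgeCot q r k + (edgeTan q r (k - 1) - edgeCot q r (k - 1)))
          * cross (q j.castSucc.succ) (q k) = 0 := fun j k =>
    congrFun (edgeOp_cross hq hX (q j.castSucc.succ)) k
  have hcol : ∀ i j, (M * K) i j
      = edgeOp (edgeTan q r) (edgeCot q r) (extendByZero fun i => K i j) i.succ.succ := by
    intro i j
    rw [← reducedMatrix_mulVec]
    rfl
  have hinner : ∀ (i : Fin m) (j : Fin (m + 1)),
      (M * K) i.castSucc j = if i.val + 1 = j.val then 2 * r ^ 2 else 0 := by
    intro i j
    have hk1 : (i.castSucc.succ.succ + 1).val = i.val + 3 := by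
      rw [Fin.val_add_one_of_lt (by simp [Fin.lt_def])]; simp
    have hk0 : (i.castSucc.succ.succ - 1).val = i.val + 1 := by
      rw [Fin.val_sub_one_of_ne_zero (Fin.succ_ne_zero _)]; simp
    have hz := hzero j i.castSucc.succ.succ
    rw [hcol, edgeOp_apply, hext, hext, hext, hk1, hk0]
    have hk : i.castSucc.succ.succ.val = i.val + 2 := rfl
    rw [hk]
    -- the row sees only zeros, or the first nonzero entry, or only untruncated entries
    rcases lt_trichotomy (i.val + 1) j.val with h | h | h
    · have h0 : (if j.val + 1 ≤ i.val + 3 then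
          cross (q j.castSucc.succ) (q (i.castSucc.succ.succ + 1)) else 0) = 0 := by
        split_ifs with h'
        · have hj : j.castSucc.succ = i.castSucc.succ.succ + 1 :=
            Fin.ext (by simp only [hk1, Fin.val_succ, Fin.val_castSucc]; omega)
          rw [hj, hself]
        · rfl
      rw [h0, if_neg (by omega), if_neg (by omega), if_neg (by omega)]
      ring
    · have hj : j.castSucc.succ = i.castSucc.succ.succ :=
        Fin.ext (by simp only [Fin.val_succ, Fin.val_castSucc]; omega)
      rw [if_pos (by omega), if_neg (by omega), if_pos (by omega), if_pos h, hj, hself,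
        edgeTan_add_edgeCot]
      have := hX i.castSucc.succ.succ
      field_simp
      ring
    · rw [if_pos (by omega), if_pos (by omega), if_pos (by omega), if_neg (by omega)]
      exact hz
  have hlast : (M * K) (Fin.last m) 0
      = 2 * r ^ 2 * (cross (q 0) (q 1) / cross (q (Fin.last (m + 2))) (q 0)) := by
    have hl : (Fin.last m).succ.succ = Fin.last (m + 2) := rfl
    have hl0 : Fin.last (m + 2) + 1 = 0 := Fin.last_add_one _
    have hlv : (Fin.last (m + 2) - 1).val = m + 1 := by
      rw [Fin.val_sub_one_of_ne_zero (Fin.last_pos.ne')]; simp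
    have hz := hzero 0 (Fin.last (m + 2))
    rw [hcol, hl, edgeOp_apply, hext, hext, hext, hlv, hl0]
    -- the successor of the last vertex is the pinned vertex `0`, where the truncation matters
    rw [if_neg (by simp), if_pos (by simp), if_pos (by simp)]
    rw [hl0] at hz
    have hX' := edgeTan_add_edgeCot q r (Fin.last (m + 2))
    rw [hl0] at hX'
    have h1 : (0 : Fin (m + 1)).castSucc.succ = (1 : Fin (m + 3)) := rfl
    have h10 : cross (q 1) (q 0) = - cross (q 0) (q 1) := by simp only [cross]; ring
    rw [h1, h10, hX'] at hz
    rw [h1, hX']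
    linear_combination hz
  rw [← hKdet, ← Matrix.det_mul, Matrix.det_succ_column_zero, Fin.sum_univ_castSucc]
  have hminor : ((M * K).submatrix (Fin.last m).succAbove Fin.succ)
      = Matrix.diagonal fun _ => 2 * r ^ 2 := by
    ext i j
    rw [Matrix.submatrix_apply, Fin.succAbove_last, hinner, Matrix.diagonal_apply]
    simp [Fin.ext_iff]
  rw [hminor, Matrix.det_diagonal, hlast]
  simp only [hinner]
  simp
  ring

/-! ### The Lagrangian of the signed area at an inscribed polygon -/

/-- The inner product of `v` and `w`, computed from their radial and tangential components along `u`. -/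
theorem inner_mul_inner_add_cross_mul_cross (u v w : Plane) :
    inner ℝ u u * inner ℝ v w = inner ℝ u v * inner ℝ u w + cross u v * cross u w := by
  simp only [inner_eq, cross]; ring

/-- The cross product of `v` and `w`, computed from their radial and tangential components along `u`. -/
theorem inner_mul_cross (u v w : Plane) :
    inner ℝ u u * cross v w = inner ℝ u v * cross u w - cross u v * inner ℝ u w := by
  simp only [inner_eq, cross]; ring

theorem cross_add_left (u v w : Plane) : cross (u + v) w = cross u w + cross v w := by
  simp only [cross, PiLp.add_apply]; ring

theorem cross_add_right (u v w : Plane) : cross u (v + w) = cross u v + cross u w := by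
  simp only [cross, PiLp.add_apply]; ring

theorem cross_smul_left (s : ℝ) (v w : Plane) : cross (s • v) w = s * cross v w := by
  simp only [cross, PiLp.smul_apply, smul_eq_mul]; ring

theorem cross_smul_right (s : ℝ) (v w : Plane) : cross v (s • w) = s * cross v w := by
  simp only [cross, PiLp.smul_apply, smul_eq_mul]; ring

theorem cross_comm (v w : Plane) : cross v w = - cross w v := by
  simp only [cross]; ring

theorem cross_self (v : Plane) : cross v v = 0 := by
  simp only [cross]; ring

/-- The polar form of the quadratic form `w ↦ A(w) - ∑ c k / 4 * |w (k + 1) - w k|²`, see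
`lagrangianForm_self`. -/
def lagrangianForm {n : ℕ} [NeZero n] (c : Fin n → ℝ) (v w : Fin n → Plane) : ℝ :=
  ∑ k, ((cross (v k) (w (k + 1)) + cross (w k) (v (k + 1))) / 4
    - c k / 4 * inner ℝ (v (k + 1) - v k) (w (k + 1) - w k))

theorem lagrangianForm_comm {n : ℕ} [NeZero n] (c : Fin n → ℝ) (v w : Fin n → Plane) :
    lagrangianForm c v w = lagrangianForm c w v := by
  refine Finset.sum_congr rfl fun k _ => ?_
  rw [real_inner_comm, add_comm]

theorem lagrangianForm_add_left {n : ℕ} [NeZero n] (c : Fin n → ℝ) (v v' w : Fin n → Plane) :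
    lagrangianForm c (v + v') w = lagrangianForm c v w + lagrangianForm c v' w := by
  simp only [lagrangianForm, ← Finset.sum_add_distrib, Pi.add_apply]
  refine Finset.sum_congr rfl fun k _ => ?_
  rw [add_sub_add_comm, inner_add_left, cross_add_left, cross_add_right]
  ring

theorem lagrangianForm_smul_left {n : ℕ} [NeZero n] (c : Fin n → ℝ) (s : ℝ)
    (v w : Fin n → Plane) : lagrangianForm c (s • v) w = s * lagrangianForm c v w := by
  simp only [lagrangianForm, Finset.mul_sum, Pi.smul_apply]
  refine Finset.sum_congr rfl fun k _ => ?_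
  rw [← smul_sub, real_inner_smul_left, cross_smul_left, cross_smul_right]
  ring

theorem lagrangianForm_self {n : ℕ} [NeZero n] (c : Fin n → ℝ) (w : Fin n → Plane) :
    lagrangianForm c w w = signedArea w
      - ∑ k, c k / 4 * inner ℝ (w (k + 1) - w k) (w (k + 1) - w k) := by
  rw [lagrangianForm, Finset.sum_sub_distrib, signedArea, Finset.sum_div]
  congr 1
  refine Finset.sum_congr rfl fun k _ => ?_
  ring

/-- A velocity field `w` on the vertices of `q` that fixes the vertices `0` and `1` and preserves all
edge lengths to first order. -/
structure IsInfinitesimalFlex {n : ℕ} [NeZero n] (q w : Fin n → Plane) : Prop where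
  zero : w 0 = 0
  one : w 1 = 0
  inner_eq_zero : ∀ k, inner ℝ (q (k + 1) - q k) (w (k + 1) - w k) = 0

/-- The components of `w` along the position vectors of the vertices, without normalization by the
length of `q k`. -/
def radial {n : ℕ} (q w : Fin n → Plane) (k : Fin n) : ℝ := inner ℝ (q k) (w k)

theorem radial_add {n : ℕ} (q v w : Fin n → Plane) : radial q (v + w) = radial q v + radial q w := by
  ext k; exact inner_add_right _ _ _

theorem radial_smul {n : ℕ} (q w : Fin n → Plane) (s : ℝ) : radial q (s • w) = s • radial q w := by
  ext k; exact real_inner_smul_right _ _ _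

theorem IsInfinitesimalFlex.add {n : ℕ} [NeZero n] {q v w : Fin n → Plane}
    (hv : IsInfinitesimalFlex q v) (hw : IsInfinitesimalFlex q w) :
    IsInfinitesimalFlex q (v + w) where
  zero := by simp [hv.zero, hw.zero]
  one := by simp [hv.one, hw.one]
  inner_eq_zero k := by
    rw [Pi.add_apply, Pi.add_apply, add_sub_add_comm, inner_add_right, hv.inner_eq_zero,
      hw.inner_eq_zero, add_zero]

section Inscribed

variable {n : ℕ} [NeZero n] {q : Fin n → Plane} {r : ℝ}

theorem inner_sq_add_cross_sq (hq : ∀ k, inner ℝ (q k) (q k) = r ^ 2) (k : Fin n) :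
    inner ℝ (q k) (q (k + 1)) ^ 2 + cross (q k) (q (k + 1)) ^ 2 = r ^ 2 * r ^ 2 := by
  have := inner_mul_inner_add_cross_mul_cross (q k) (q (k + 1)) (q (k + 1))
  rw [hq, hq] at this
  linear_combination -this

theorem edgeCot_mul_edgeTan (hq : ∀ k, inner ℝ (q k) (q k) = r ^ 2)
    (hX : ∀ k, cross (q k) (q (k + 1)) ≠ 0) (k : Fin n) : edgeCot q r k * edgeTan q r k = 1 := by
  have h := inner_sq_add_cross_sq hq k
  have hx := hX k
  rw [edgeCot, edgeTan]
  field_simp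
  linear_combination -h

/-- An inscribed polygon with center at the origin is a critical point of the Lagrangian: `c k` times
the edge vector is the quarter turn of `q k + q (k + 1)`, so the first variation telescopes. -/
theorem lagrangianForm_eq_zero (hq : ∀ k, inner ℝ (q k) (q k) = r ^ 2)
    (hX : ∀ k, cross (q k) (q (k + 1)) ≠ 0) (w : Fin n → Plane) :
    lagrangianForm (edgeCot q r) q w = 0 := by
  have key : ∀ k, edgeCot q r k * inner ℝ (q (k + 1) - q k) (w (k + 1) - w k)
      = cross (q k + q (k + 1)) (w (k + 1) - w k) := by
    intro k
    have h1 : ∀ u v z : Plane, inner ℝ u u * inner ℝ v z - inner ℝ u v * inner ℝ u z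
        = cross u v * cross u z := by
      intro u v z
      rw [inner_mul_inner_add_cross_mul_cross]; ring
    have h2 := h1 (q k) (q (k + 1)) (w (k + 1) - w k)
    have h3 := h1 (q (k + 1)) (q k) (w (k + 1) - w k)
    rw [hq] at h2 h3
    rw [real_inner_comm (q k) (q (k + 1)), cross_comm (q (k + 1)) (q k)] at h3
    have hx := hX k
    rw [edgeCot, inner_sub_left, cross_add_left]
    field_simp
    linear_combination h2 - h3
  have h4 : lagrangianForm (edgeCot q r) q w
      = ∑ k, (cross (q k) (w k) / 4 - cross (q (k + 1)) (w (k + 1)) / 4) := by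
    refine Finset.sum_congr rfl fun k _ => ?_
    have := key k
    simp only [cross, PiLp.add_apply, PiLp.sub_apply] at this ⊢
    linear_combination (-1 / 4 : ℝ) * this
  rw [h4, Finset.sum_sub_distrib, sum_add_one fun k => cross (q k) (w k) / 4, sub_self]

theorem lagrangianForm_add_const (c : Fin n → ℝ) (O : Plane) (w : Fin n → Plane) :
    lagrangianForm c (fun k => q k + O) w = lagrangianForm c q w := by
  have h : lagrangianForm c (fun k => q k + O) w
      = lagrangianForm c q w + ∑ k, (cross O (w (k + 1)) / 4 - cross O (w k) / 4) := by
    rw [lagrangianForm, lagrangianForm, ← Finset.sum_add_distrib]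
    refine Finset.sum_congr rfl fun k _ => ?_
    rw [add_sub_add_right_eq_sub, cross_add_left, cross_add_right, cross_comm (w k) O]
    ring
  rw [h, Finset.sum_sub_distrib, sum_add_one fun k => cross O (w k) / 4, sub_self, add_zero]

/-- Along a flex, the radial components determine the increments of the tangential components. -/
theorem cross_succ_sub_cross (hq : ∀ k, inner ℝ (q k) (q k) = r ^ 2)
    (hX : ∀ k, cross (q k) (q (k + 1)) ≠ 0) {w : Fin n → Plane}
    (hw : IsInfinitesimalFlex q w) (k : Fin n) :
    cross (q (k + 1)) (w (k + 1)) - cross (q k) (w k)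
      = - (edgeTan q r k * (radial q w k + radial q w (k + 1))) := by
  have h1 := inner_mul_inner_add_cross_mul_cross (q k) (q (k + 1)) (w k)
  have h2 := inner_mul_inner_add_cross_mul_cross (q (k + 1)) (q k) (w (k + 1))
  have h3 := hw.inner_eq_zero k
  rw [inner_sub_left, inner_sub_right, inner_sub_right] at h3
  rw [hq] at h1 h2
  rw [real_inner_comm (q k) (q (k + 1)), cross_comm (q (k + 1)) (q k)] at h2
  have hx := hX k
  rw [edgeTan, radial, radial]
  field_simp
  linear_combination r ^ 2 * h3 + h1 + h2

/-- The tangential increments sum to zero around the polygon: the radial part of a flex is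
`edgeForm`-orthogonal to the constant sequence `1`. -/
theorem sum_edgeTan_mul_radial (hq : ∀ k, inner ℝ (q k) (q k) = r ^ 2)
    (hX : ∀ k, cross (q k) (q (k + 1)) ≠ 0) {w : Fin n → Plane}
    (hw : IsInfinitesimalFlex q w) :
    edgeForm (edgeTan q r) (edgeCot q r) (radial q w) 1 = 0 := by
  rw [edgeForm_one_right, ← neg_eq_zero, ← mul_neg, ← Finset.sum_neg_distrib]
  simp only [← cross_succ_sub_cross hq hX hw]
  rw [Finset.sum_sub_distrib, sum_add_one fun k => cross (q k) (w k), sub_self, mul_zero]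

theorem sq_mul_lagrangianForm_self (hr : r ≠ 0) (hq : ∀ k, inner ℝ (q k) (q k) = r ^ 2)
    (hX : ∀ k, cross (q k) (q (k + 1)) ≠ 0) {w : Fin n → Plane}
    (hw : IsInfinitesimalFlex q w) :
    r ^ 2 * lagrangianForm (edgeCot q r) w w
      = edgeForm (edgeTan q r) (edgeCot q r) (radial q w) (radial q w) / 4 := by
  have key : ∀ k, r ^ 2 * ((cross (w k) (w (k + 1)) + cross (w k) (w (k + 1))) / 4
      - edgeCot q r k / 4 * inner ℝ (w (k + 1) - w k) (w (k + 1) - w k))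
      = (edgeTan q r k * (radial q w k + radial q w (k + 1)) * (radial q w k + radial q w (k + 1))
        - edgeCot q r k * (radial q w k - radial q w (k + 1))
          * (radial q w k - radial q w (k + 1))) / 4
        + (radial q w (k + 1) * cross (q (k + 1)) (w (k + 1)) / 2
          - radial q w k * cross (q k) (w k) / 2) := by
    intro k
    have hrot := cross_succ_sub_cross hq hX hw k
    have hct := edgeCot_mul_edgeTan hq hX k
    have hSX := inner_sq_add_cross_sq hq k
    have hedge : r ^ 2 * (cross (w k) (w (k + 1)) / 2
      - edgeCot q r k / 4 * inner ℝ (w (k + 1) - w k) (w (k + 1) - w k))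
        = - (radial q w k * cross (q (k + 1)) (w (k + 1))
            - cross (q k) (w k) * radial q w (k + 1)) / 2
          - edgeCot q r k / 4 * ((radial q w k - radial q w (k + 1)) ^ 2
            + (cross (q k) (w k) - cross (q (k + 1)) (w (k + 1))) ^ 2) := by
      have hx := hX k
      have hN := inner_mul_inner_add_cross_mul_cross (q k) (w k) (w k)
      have hN' := inner_mul_inner_add_cross_mul_cross (q (k + 1)) (w (k + 1)) (w (k + 1))
      have h1 := inner_mul_inner_add_cross_mul_cross (q k) (w k) (w (k + 1))
      have h2 := inner_mul_cross (q k) (w k) (w (k + 1))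
      have h3 := inner_mul_inner_add_cross_mul_cross (q (k + 1)) (q k) (w (k + 1))
      have h4 := inner_mul_cross (q (k + 1)) (q k) (w (k + 1))
      rw [hq] at hN hN' h1 h2 h3 h4
      rw [real_inner_comm (q k) (q (k + 1)), cross_comm (q (k + 1)) (q k)] at h3 h4
      rw [real_inner_sub_sub_self, real_inner_comm (w k) (w (k + 1))]
      have hcX : edgeCot q r k * cross (q k) (q (k + 1))
          = r ^ 2 + inner ℝ (q k) (q (k + 1)) := div_mul_cancel₀ _ hx
      have hcS : edgeCot q r k * inner ℝ (q k) (q (k + 1))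
          = edgeCot q r k * r ^ 2 - cross (q k) (q (k + 1)) := by
        rw [edgeTan] at hct
        field_simp at hct
        linear_combination -hct
      rw [radial, radial]
      refine mul_left_cancel₀ (pow_ne_zero 2 hr) ?_
      generalize edgeCot q r k = c at *
      generalize inner ℝ (q k) (q (k + 1)) = S at *
      generalize cross (q k) (q (k + 1)) = X at *
      generalize inner ℝ (q k) (w k) = a at *
      generalize inner ℝ (q (k + 1)) (w (k + 1)) = a' at *
      generalize cross (q k) (w k) = b at *
      generalize cross (q (k + 1)) (w (k + 1)) = b' at *
      linear_combination (1 / 2) * (r ^ 2 * h2 + a * h4 - b * h3)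
        + (c / 2) * (r ^ 2 * h1 + a * h3 + b * h4) - (c / 4) * r ^ 2 * (hN + hN')
        + (a * a' + b * b') / 2 * hcS - (a * b' - b * a') / 2 * hcX
    have hb : cross (q (k + 1)) (w (k + 1)) = cross (q k) (w k)
        - edgeTan q r k * (radial q w k + radial q w (k + 1)) := by
      linear_combination hrot
    rw [hb] at hedge ⊢
    linear_combination hedge - edgeTan q r k
      * (radial q w k + radial q w (k + 1)) ^ 2 / 4 * hct
  rw [lagrangianForm, Finset.mul_sum, Finset.sum_congr rfl fun k _ => key k,
    Finset.sum_add_distrib, Finset.sum_sub_distrib (f := fun k => _ / 2),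
    sum_add_one fun k => radial q w k * cross (q k) (w k) / 2, sub_self, add_zero, edgeForm,
    Finset.sum_div]

theorem sq_mul_lagrangianForm (hr : r ≠ 0) (hq : ∀ k, inner ℝ (q k) (q k) = r ^ 2)
    (hX : ∀ k, cross (q k) (q (k + 1)) ≠ 0) {v w : Fin n → Plane}
    (hv : IsInfinitesimalFlex q v) (hw : IsInfinitesimalFlex q w) :
    r ^ 2 * lagrangianForm (edgeCot q r) v w
      = edgeForm (edgeTan q r) (edgeCot q r) (radial q v) (radial q w) / 4 := by
  have h1 := sq_mul_lagrangianForm_self hr hq hX (hv.add hw)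
  have h2 := sq_mul_lagrangianForm_self hr hq hX hv
  have h3 := sq_mul_lagrangianForm_self hr hq hX hw
  have h4 : lagrangianForm (edgeCot q r) (v + w) (v + w) = lagrangianForm (edgeCot q r) v v
      + lagrangianForm (edgeCot q r) w w + 2 * lagrangianForm (edgeCot q r) v w := by
    rw [lagrangianForm_add_left, lagrangianForm_comm _ v (v + w), lagrangianForm_comm _ w (v + w),
      lagrangianForm_add_left, lagrangianForm_add_left, lagrangianForm_comm _ w v]
    ring
  have h5 : ∀ a b : Fin n → ℝ, edgeForm (edgeTan q r) (edgeCot q r) (a + b) (a + b)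
      = edgeForm (edgeTan q r) (edgeCot q r) a a + edgeForm (edgeTan q r) (edgeCot q r) b b
        + 2 * edgeForm (edgeTan q r) (edgeCot q r) a b := by
    intro a b
    simp only [edgeForm, Finset.mul_sum, ← Finset.sum_add_distrib, Pi.add_apply]
    refine Finset.sum_congr rfl fun k _ => ?_
    ring
  rw [h4, radial_add, h5] at h1
  linear_combination (h1 - h2 - h3) / 2

/-- A flex without radial part is an infinitesimal rotation, and the pinned vertex forbids it. -/
theorem eq_zero_of_radial_eq_zero (hr : r ≠ 0) (hq : ∀ k, inner ℝ (q k) (q k) = r ^ 2)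
    (hX : ∀ k, cross (q k) (q (k + 1)) ≠ 0) {w : Fin n → Plane}
    (hw : IsInfinitesimalFlex q w) (h : radial q w = 0) : w = 0 := by
  obtain ⟨n, rfl⟩ : ∃ n', n = n' + 1 := ⟨n - 1, by have := NeZero.pos n; omega⟩
  have hcross : ∀ k, cross (q k) (w k) = 0 := by
    intro k
    induction k using Fin.induction with
    | zero => rw [hw.zero]; simp [cross]
    | succ k ih =>
      have := cross_succ_sub_cross hq hX hw k.castSucc
      rw [h, ih, Fin.coeSucc_eq_succ] at this
      simpa using this
  ext1 k
  have h1 := inner_mul_inner_add_cross_mul_cross (q k) (w k) (w k)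
  have h2 : inner ℝ (q k) (w k) = 0 := congrFun h k
  rw [hcross, h2, hq, mul_zero, add_zero] at h1
  exact inner_self_eq_zero.1 ((mul_eq_zero.1 h1).resolve_left (pow_ne_zero 2 hr))

/-- The constant sequence `1` minus the linear functional of the vertices that is `1` at `q 0` and
`q 1`. It vanishes at the vertices on the line through `q 0` and `q 1`. -/
def chordDefect (q : Fin n → Plane) (k : Fin n) : ℝ :=
  1 - cross ((cross (q 0) (q 1))⁻¹ • (q 0 - q 1)) (q k)

theorem chordDefect_zero (h : cross (q 0) (q 1) ≠ 0) : chordDefect q 0 = 0 := by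
  have h1 : cross (q 0 - q 1) (q 0) = cross (q 0) (q 1) := by
    simp only [cross, PiLp.sub_apply]; ring
  rw [chordDefect, cross_smul_left, h1, inv_mul_cancel₀ h, sub_self]

theorem chordDefect_one (h : cross (q 0) (q 1) ≠ 0) : chordDefect q 1 = 0 := by
  have h1 : cross (q 0 - q 1) (q 1) = cross (q 0) (q 1) := by
    simp only [cross, PiLp.sub_apply]; ring
  rw [chordDefect, cross_smul_left, h1, inv_mul_cancel₀ h, sub_self]

theorem edgeForm_chordDefect (hq : ∀ k, inner ℝ (q k) (q k) = r ^ 2)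
    (hX : ∀ k, cross (q k) (q (k + 1)) ≠ 0) (b : Fin n → ℝ) :
    edgeForm (edgeTan q r) (edgeCot q r) (chordDefect q) b
      = edgeForm (edgeTan q r) (edgeCot q r) b 1 := by
  have h1 : chordDefect q = 1 - fun k => cross ((cross (q 0) (q 1))⁻¹ • (q 0 - q 1)) (q k) := rfl
  rw [edgeForm_comm _ _ b 1, edgeForm_eq_sum, edgeForm_eq_sum, h1, map_sub, edgeOp_cross hq hX,
    sub_zero]

theorem edgeForm_chordDefect_self (hq : ∀ k, inner ℝ (q k) (q k) = r ^ 2)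
    (hX : ∀ k, cross (q k) (q (k + 1)) ≠ 0) :
    edgeForm (edgeTan q r) (edgeCot q r) (chordDefect q) (chordDefect q)
      = 4 * ∑ k, edgeTan q r k := by
  rw [edgeForm_chordDefect hq hX, edgeForm_chordDefect hq hX, edgeForm_one_right,
    Finset.mul_sum, Finset.mul_sum]
  refine Finset.sum_congr rfl fun k _ => ?_
  simp only [Pi.one_apply]; ring

theorem collinear_of_chordDefect_eq_zero (h : cross (q 0) (q 1) ≠ 0) (h0 : chordDefect q = 0) :
    Collinear ℝ (Set.range q) := by
  rw [collinear_iff_of_mem (Set.mem_range_self (0 : Fin n))]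
  refine ⟨q 1 - q 0, ?_⟩
  rintro _ ⟨k, rfl⟩
  have h1 : cross (q 1 - q 0) (q k - q 0) = 0 := by
    have h2 : cross (q 0) (q 1) = cross (q 0 - q 1) (q k) := by
      have := congrFun h0 k
      rw [chordDefect, cross_smul_left, Pi.zero_apply] at this
      field_simp at this
      linear_combination this
    simp only [cross, PiLp.sub_apply] at h2 ⊢
    linear_combination h2
  have hd : inner ℝ (q 1 - q 0) (q 1 - q 0) ≠ (0 : ℝ) := by
    intro hd
    rw [inner_self_eq_zero, sub_eq_zero] at hd
    exact h (by rw [hd, cross_self])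
  refine ⟨inner ℝ (q 1 - q 0) (q k - q 0) / inner ℝ (q 1 - q 0) (q 1 - q 0), ?_⟩
  rw [vadd_eq_add, ← sub_eq_iff_eq_add]
  refine smul_right_injective _ hd ?_
  simp only [smul_smul, mul_div_cancel₀ _ hd]
  generalize q 1 - q 0 = d at *
  generalize q k - q 0 = z at *
  rw [cross] at h1
  ext i
  fin_cases i
  · rw [inner_eq, inner_eq]; simp; linear_combination (-d 1) * h1
  · rw [inner_eq, inner_eq]; simp; linear_combination d 0 * h1

end Inscribed

/-! ### The Hessian along the constraints -/

/-- If `f` is the quadratic form of `B` composed with `φ`, up to a constant, and `φ u` is a critical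
point of that form, then the second derivative of `φ` does not contribute to that of `f` at `u`. -/
theorem fderiv_fderiv_comp_quadratic {E V : Type*} [NormedAddCommGroup E] [NormedSpace ℝ E]
    [NormedAddCommGroup V] [NormedSpace ℝ V]
    (B : E →L[ℝ] E →L[ℝ] ℝ) (hB : ∀ x y, B x y = B y x) {φ : V → E} {U : Set V} (hU : IsOpen U)
    (hφ : ContDiffOn ℝ ∞ φ U) {u : V} (hu : u ∈ U) (hcrit : B (φ u) = 0) {f : V → ℝ} (C : ℝ)
    (hf : ∀ v ∈ U, f v = B (φ v) (φ v) + C) (x y : V) :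
    fderiv ℝ (fun v => fderiv ℝ f v y) u x = 2 * B (fderiv ℝ φ u x) (fderiv ℝ φ u y) := by
  have hd : ∀ v ∈ U, DifferentiableAt ℝ φ v := fun v hv =>
    (hφ.contDiffAt (hU.mem_nhds hv)).differentiableAt (by simp)
  -- the formula is needed on a neighborhood, as it is differentiated again
  have h1 : ∀ v ∈ U, fderiv ℝ f v y = 2 * B (φ v) (fderiv ℝ φ v y) := by
    intro v hv
    have h2 : HasFDerivAt (fun v => B (φ v) (φ v) + C) _ v :=
      (B.hasFDerivAt_of_bilinear (hd v hv).hasFDerivAt (hd v hv).hasFDerivAt).add_const C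
    have h3 := h2.congr_of_eventuallyEq (f₁ := f) (Filter.eventually_of_mem (hU.mem_nhds hv) hf)
    rw [h3.fderiv]
    simp [ContinuousLinearMap.precompR_apply, ContinuousLinearMap.precompL_apply,
      hB (fderiv ℝ φ v y) (φ v)]
    ring
  have hd2 : DifferentiableAt ℝ (fun v => fderiv ℝ φ v y) u := by
    have : ContDiffAt ℝ 1 (fderiv ℝ φ) u :=
      (hφ.contDiffAt (hU.mem_nhds hu)).fderiv_right (m := 1) (by norm_cast)
    exact (this.differentiableAt (by simp)).clm_apply (differentiableAt_const y)
  have h4 := (B.hasFDerivAt_of_bilinear (hd u hu).hasFDerivAt hd2.hasFDerivAt).const_mul 2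
  have h5 := h4.congr_of_eventuallyEq (f₁ := fun v => fderiv ℝ f v y)
    (Filter.eventually_of_mem (hU.mem_nhds hu) h1)
  rw [h5.fderiv]
  simp [ContinuousLinearMap.precompR_apply, ContinuousLinearMap.precompL_apply, hcrit]

/-- The space of polygons is finite-dimensional, so the bilinear form is continuous. -/
theorem exists_clm_lagrangianForm {n : ℕ} [NeZero n] (c : Fin n → ℝ) :
    ∃ B : (Fin n → Plane) →L[ℝ] (Fin n → Plane) →L[ℝ] ℝ, ∀ v w, B v w = lagrangianForm c v w := by
  let B₀ : (Fin n → Plane) →ₗ[ℝ] (Fin n → Plane) →ₗ[ℝ] ℝ :=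
    LinearMap.mk₂ ℝ (lagrangianForm c) (lagrangianForm_add_left c) (lagrangianForm_smul_left c)
      (fun v w w' => by
        rw [lagrangianForm_comm, lagrangianForm_add_left, lagrangianForm_comm _ w,
          lagrangianForm_comm _ w'])
      (fun s v w => by
        rw [lagrangianForm_comm, lagrangianForm_smul_left, lagrangianForm_comm _ w, smul_eq_mul])
  exact ⟨LinearMap.toContinuousBilinearMap B₀, fun v w => rfl⟩

/-- The pinned vertices together with the squared lengths of the edges `1, …, n - 1`. The edge `0` is
omitted: its length is determined by the pinned vertices, and it would make the constraints
dependent. -/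
def constraintMap {m : ℕ} (p : Fin (m + 3) → Plane) : (Plane × Plane) × (Fin (m + 2) → ℝ) :=
  ((p 0, p 1), fun k => inner ℝ (p (k.succ + 1) - p k.succ) (p (k.succ + 1) - p k.succ))

theorem contDiff_constraintMap {m : ℕ} : ContDiff ℝ ∞ (constraintMap (m := m)) := by
  unfold constraintMap
  refine ((contDiff_apply _ _ _).prodMk (contDiff_apply _ _ _)).prodMk (contDiff_pi.2 fun k => ?_)
  have h : ContDiff ℝ ∞ fun p : Fin (m + 3) → Plane => p (k.succ + 1) - p k.succ :=
    (contDiff_apply _ _ _).sub (contDiff_apply _ _ _)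
  exact h.inner ℝ h

theorem fderiv_constraintMap {m : ℕ} (p w : Fin (m + 3) → Plane) :
    fderiv ℝ constraintMap p w = ((w 0, w 1),
      fun k => 2 * inner ℝ (p (k.succ + 1) - p k.succ) (w (k.succ + 1) - w k.succ)) := by
  have hp : ∀ k : Fin (m + 3), HasFDerivAt (fun p : Fin (m + 3) → Plane => p k)
      (ContinuousLinearMap.proj (R := ℝ) (φ := fun _ : Fin (m + 3) => Plane) k) p :=
    fun k => hasFDerivAt_apply k p
  have hk : ∀ k : Fin (m + 2), HasFDerivAt (fun p : Fin (m + 3) → Plane =>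
      (inner ℝ (p (k.succ + 1) - p k.succ) (p (k.succ + 1) - p k.succ) : ℝ)) _ p := fun k =>
    ((hp (k.succ + 1)).sub (hp k.succ)).inner ℝ ((hp (k.succ + 1)).sub (hp k.succ))
  have h : HasFDerivAt constraintMap _ p :=
    ((hp 0).prodMk (hp 1)).prodMk (hasFDerivAt_pi.2 hk)
  rw [h.fderiv]
  refine Prod.ext rfl (funext fun k => ?_)
  simp [fderivInnerCLM_apply, real_inner_comm]
  ring

theorem isInfinitesimalFlex_of_fderiv_constraintMap_eq_zero {m : ℕ} {p w : Fin (m + 3) → Plane}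
    (h : fderiv ℝ constraintMap p w = 0) : IsInfinitesimalFlex p w := by
  rw [fderiv_constraintMap] at h
  have h0 : w 0 = 0 := congrArg (fun z => z.1.1) h
  have h1 : w 1 = 0 := congrArg (fun z => z.1.2) h
  refine ⟨h0, h1, fun k => ?_⟩
  refine Fin.cases ?_ (fun k => ?_) k
  · rw [zero_add, h0, h1, sub_self, inner_zero_right]
  · have : 2 * inner ℝ (p (k.succ + 1) - p k.succ) (w (k.succ + 1) - w k.succ) = (0 : ℝ) :=
      congrArg (fun z => z.2 k) h
    simpa using this

theorem moduliSpace_eq_constraintMap_levelSet {m : ℕ} {l : Fin (m + 3) → ℝ} (hl : ∀ i, 0 < l i)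
    {P : Fin (m + 3) → Plane} (hP : P ∈ moduliSpace l) :
    moduliSpace l = {p | constraintMap p = constraintMap P} := by
  obtain ⟨hPd, hP0, hP1⟩ := hP
  have hsq : ∀ (p : Fin (m + 3) → Plane) (i : Fin (m + 3)),
      inner ℝ (p (i + 1) - p i) (p (i + 1) - p i) = dist (p i) (p (i + 1)) ^ 2 := fun p i => by
    rw [real_inner_self_eq_norm_sq, dist_comm, dist_eq_norm]
  ext p
  constructor
  · rintro ⟨hd, h0, h1⟩
    refine Prod.ext (Prod.ext (h0.trans hP0.symm) (h1.trans hP1.symm)) (funext fun k => ?_)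
    simp only [constraintMap, hsq, hd, hPd]
  · intro h
    have h0 : p 0 = P 0 := congrArg (fun z => z.1.1) h
    have h1 : p 1 = P 1 := congrArg (fun z => z.1.2) h
    refine ⟨fun i => ?_, h0.trans hP0, h1.trans hP1⟩
    refine Fin.cases ?_ (fun k => ?_) i
    · rw [← hPd 0, zero_add, h0, h1]
    · have : inner ℝ (p (k.succ + 1) - p k.succ) (p (k.succ + 1) - p k.succ)
          = inner ℝ (P (k.succ + 1) - P k.succ) (P (k.succ + 1) - P k.succ) :=
        congrArg (fun z => z.2 k) h
      rw [hsq, hsq, hPd] at this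
      exact (pow_left_inj₀ dist_nonneg (hl _).le two_ne_zero).1 this

/-- The derivative of a parametrization of a level set takes values in the tangent space. -/
theorem IsLocalParametrization.fderiv_apply_eq_zero {E F : Type*} [NormedAddCommGroup E]
    [NormedSpace ℝ E] [NormedAddCommGroup F] [NormedSpace ℝ F] {k : ℕ} {G : E → F} {P : E}
    {U : Set (Fin k → ℝ)} {φ : (Fin k → ℝ) → E} {u : Fin k → ℝ}
    (h : IsLocalParametrization {x | G x = G P} P U φ u) (hG : DifferentiableAt ℝ G P)
    (x : Fin k → ℝ) : fderiv ℝ G P (fderiv ℝ φ u x) = 0 := by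
  obtain ⟨W, -, hW⟩ := h.image_eq
  have hU := h.isOpen.mem_nhds h.mem
  have hφ : HasFDerivAt φ (fderiv ℝ φ u) u :=
    ((h.contDiffOn.contDiffAt hU).differentiableAt (by simp)).hasFDerivAt
  have hG' : HasFDerivAt G (fderiv ℝ G P) (φ u) := by rw [h.map_eq]; exact hG.hasFDerivAt
  have h1 := hG'.comp u hφ
  have h2 : HasFDerivAt (G ∘ φ) (0 : (Fin k → ℝ) →L[ℝ] F) u :=
    (hasFDerivAt_const (G P) u).congr_of_eventuallyEq <|
      Filter.eventually_of_mem hU fun v hv => (hW.subset ⟨v, hv, rfl⟩).1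
  exact congrArg (fun T => T x) (h1.unique h2)

/-! ### Signs, and regularity of the constraints at an inscribed polygon -/

/-- Two points of a circle around the origin that are neither equal nor antipodal are linearly
independent. -/
theorem cross_ne_zero_of_inner_self_eq {u v : Plane} {r : ℝ} (hu : inner ℝ u u = r ^ 2)
    (hv : inner ℝ v v = r ^ 2) (hne : u ≠ v) (hadd : u + v ≠ 0) : cross u v ≠ 0 := by
  intro h
  have h1 := inner_mul_inner_add_cross_mul_cross u v v
  rw [hu, hv, h] at h1
  have h2 : (r ^ 2 - inner ℝ u v) * (r ^ 2 + inner ℝ u v) = 0 := by linear_combination h1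
  rcases mul_eq_zero.1 h2 with h3 | h3
  · apply hne
    rw [← sub_eq_zero, ← inner_self_eq_zero (𝕜 := ℝ), real_inner_sub_sub_self]
    linear_combination hu + hv + 2 * h3
  · apply hadd
    rw [← inner_self_eq_zero (𝕜 := ℝ), real_inner_add_add_self]
    linear_combination hu + hv + 2 * h3

theorem sign_cross_mul_tan_half_angle {u v : Plane} {r : ℝ} (hr : 0 < r) (hu : ‖u‖ = r)
    (hv : ‖v‖ = r) (hX : cross u v ≠ 0) :
    (SignType.sign (cross u v) : ℝ) * Real.tan (InnerProductGeometry.angle u v / 2)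
      = (r ^ 2 - inner ℝ u v) / cross u v := by
  set θ := InnerProductGeometry.angle u v / 2 with hθ
  have h0 : 0 ≤ θ := by have := InnerProductGeometry.angle_nonneg u v; positivity
  have h1 : θ ≤ Real.pi / 2 := by have := InnerProductGeometry.angle_le_pi u v; linarith
  have hcos : inner ℝ u v = r ^ 2 * Real.cos (2 * θ) := by
    have : 2 * θ = InnerProductGeometry.angle u v := by rw [hθ]; ring
    rw [this, ← InnerProductGeometry.cos_angle_mul_norm_mul_norm u v, hu, hv]; ring
  have hS := inner_mul_inner_add_cross_mul_cross u v v
  rw [real_inner_self_eq_norm_sq, real_inner_self_eq_norm_sq, hu, hv] at hS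
  have hs0 : 0 ≤ Real.sin θ := Real.sin_nonneg_of_nonneg_of_le_pi h0 (by linarith [Real.pi_pos])
  have hc0 : 0 ≤ Real.cos θ := Real.cos_nonneg_of_neg_pi_div_two_le_of_le (by linarith) h1
  have hsc := Real.sin_sq_add_cos_sq θ
  rw [Real.cos_two_mul] at hcos
  have habs : |cross u v| = 2 * r ^ 2 * (Real.sin θ * Real.cos θ) := by
    rw [← abs_of_nonneg (by positivity : 0 ≤ 2 * r ^ 2 * (Real.sin θ * Real.cos θ)),
      ← sq_eq_sq_iff_abs_eq_abs]
    rw [hcos] at hS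
    linear_combination -hS - 4 * r ^ 4 * Real.cos θ ^ 2 * hsc
  have hc : Real.cos θ ≠ 0 := by
    intro hc
    rw [hc, mul_zero, mul_zero, abs_eq_zero] at habs
    exact hX habs
  have htan : |cross u v| * Real.tan θ = r ^ 2 - inner ℝ u v := by
    rw [habs, hcos, Real.tan_eq_sin_div_cos]
    field_simp
    linear_combination 2 * hsc
  rw [eq_div_iff hX, ← htan]
  have h4 := sign_mul_self (cross u v)
  linear_combination Real.tan θ * h4

theorem sign_det_reducedMatrix {m : ℕ} {q : Fin (m + 3) → Plane} {r : ℝ} (hr : r ≠ 0)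
    (hq : ∀ k, inner ℝ (q k) (q k) = r ^ 2) (hX : ∀ k, cross (q k) (q (k + 1)) ≠ 0) :
    SignType.sign (reducedMatrix (edgeTan q r) (edgeCot q r)).det
      = (-1) ^ m * ∏ k, SignType.sign (cross (q k) (q (k + 1))) := by
  have h := congrArg SignType.sign (det_reducedMatrix hq hX)
  have hl := hX (Fin.last (m + 2))
  rw [Fin.last_add_one] at hl
  have hdiv : cross (q 0) (q 1) / cross (q (Fin.last (m + 2))) (q 0)
      = cross (q 0) (q 1) * cross (q (Fin.last (m + 2))) (q 0)
        * (cross (q (Fin.last (m + 2))) (q 0) ^ 2)⁻¹ := by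
    field_simp
  have hprod : SignType.sign (∏ i : Fin (m + 1), cross (q i.castSucc.succ) (q i.succ.succ))
      = ∏ i : Fin (m + 1), SignType.sign (cross (q i.castSucc.succ) (q i.succ.succ)) :=
    map_prod signHom _ _
  have hsq : ∀ {x : ℝ}, x ≠ 0 → SignType.sign x * SignType.sign x = 1 := fun {x} hx => by
    rw [← sign_mul, sign_pos (mul_self_pos.2 hx)]
  have hneg : SignType.sign ((-1 : ℝ) ^ m) = (-1) ^ m := by
    rw [sign_pow, Left.sign_neg, sign_one]
  rw [hdiv, sign_mul, hprod, sign_mul, sign_mul, sign_mul, sign_mul, hneg,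
    sign_pos (by positivity : 0 < (2 * r ^ 2) ^ (m + 1)),
    sign_pos (by positivity : 0 < (cross (q (Fin.last (m + 2))) (q 0) ^ 2)⁻¹), mul_one,
    mul_one] at h
  -- signs square to `1`, so these factors can be moved to the other side of `h`
  have hmid : (∏ i : Fin (m + 1), SignType.sign (cross (q i.castSucc.succ) (q i.succ.succ)))
      * (∏ i : Fin (m + 1), SignType.sign (cross (q i.castSucc.succ) (q i.succ.succ))) = 1 := by
    rw [← Finset.prod_mul_distrib]
    refine Finset.prod_eq_one fun i _ => hsq ?_
    have := hX i.castSucc.succ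
    have h' : i.castSucc.succ + 1 = i.succ.succ := by
      rw [Fin.succ_castSucc, Fin.coeSucc_eq_succ]
    rwa [h'] at this
  have hsplit : ∏ k, SignType.sign (cross (q k) (q (k + 1)))
      = SignType.sign (cross (q 0) (q 1))
        * (∏ i : Fin (m + 1), SignType.sign (cross (q i.castSucc.succ) (q i.succ.succ)))
        * SignType.sign (cross (q (Fin.last (m + 2))) (q 0)) := by
    rw [Fin.prod_univ_castSucc, Fin.prod_univ_succ, Fin.last_add_one]
    simp only [Fin.coeSucc_eq_succ]
    rfl
  rw [hsplit]
  calc _ = SignType.sign (reducedMatrix (edgeTan q r) (edgeCot q r)).det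
        * ((∏ i : Fin (m + 1), SignType.sign (cross (q i.castSucc.succ) (q i.succ.succ)))
          * (∏ i : Fin (m + 1), SignType.sign (cross (q i.castSucc.succ) (q i.succ.succ)))) := by
        rw [hmid, mul_one]
    _ = _ := by rw [← mul_assoc, h]; ac_rfl

/-- The product is `-1` to the number of negative factors, which is `m + 3` minus the number of
positive ones. -/
theorem prod_sign_eq {m : ℕ} {s : Fin (m + 3) → SignType} (hs : ∀ k, s k ≠ 0) :
    (-1) ^ m * ∏ k, s k = -(-1) ^ (Finset.univ.filter fun k => s k = 1).card := by
  have h1 : ∏ k, s k = ∏ k, if s k = 1 then (1 : SignType) else -1 := by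
    refine Finset.prod_congr rfl fun k _ => ?_
    have := hs k
    revert this
    generalize s k = x
    revert x
    decide
  rw [h1, Finset.prod_ite, Finset.prod_const_one, one_mul, Finset.prod_const]
  have h2 := Finset.card_filter_add_card_filter_not (s := (Finset.univ : Finset (Fin (m + 3))))
    (fun k => s k = 1)
  rw [Finset.card_univ, Fintype.card_fin] at h2
  have h3 : ∀ a : ℕ, (-1 : SignType) ^ a * (-1) ^ a = 1 := fun a => by
    rw [← mul_pow]; exact one_pow a
  generalize (Finset.univ.filter fun k => s k = 1).card = a at *
  generalize (Finset.univ.filter fun k => ¬ s k = 1).card = b at *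
  have h4 : (-1 : SignType) ^ m = - ((-1) ^ a * (-1) ^ b) := by
    rw [← pow_add, h2, pow_add]
    have : (-1 : SignType) ^ 3 = -1 := by decide
    rw [this, mul_neg, neg_neg, mul_one]
  rw [h4, neg_mul, mul_assoc, h3, mul_one]

theorem chordDefect_eq_extendByZero {m : ℕ} {q : Fin (m + 3) → Plane}
    (hX : ∀ k, cross (q k) (q (k + 1)) ≠ 0) :
    chordDefect q = extendByZero fun i => chordDefect q i.succ.succ := by
  have h : cross (q 0) (q 1) ≠ 0 := hX 0
  exact eq_extendByZero (chordDefect_zero h) (chordDefect_one h)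

theorem radial_eq_extendByZero {m : ℕ} {q w : Fin (m + 3) → Plane}
    (hw : IsInfinitesimalFlex q w) :
    radial q w = extendByZero fun i => radial q w i.succ.succ := by
  refine eq_extendByZero ?_ ?_
  · rw [radial, hw.zero, inner_zero_right]
  · rw [radial, hw.one, inner_zero_right]

section Inscribed

variable {m : ℕ} {q : Fin (m + 3) → Plane} {r : ℝ}

theorem chordDefect_restrict_ne_zero (hX : ∀ k, cross (q k) (q (k + 1)) ≠ 0)
    (hcol : ¬ Collinear ℝ (Set.range q)) :
    (fun i : Fin (m + 1) => chordDefect q i.succ.succ) ≠ 0 := by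
  intro h
  refine hcol (collinear_of_chordDefect_eq_zero (hX 0) ?_)
  rw [chordDefect_eq_extendByZero hX, h, eq_comm]
  exact eq_extendByZero rfl rfl

theorem radial_dotProduct_eq_zero (hq : ∀ k, inner ℝ (q k) (q k) = r ^ 2)
    (hX : ∀ k, cross (q k) (q (k + 1)) ≠ 0) {w : Fin (m + 3) → Plane}
    (hw : IsInfinitesimalFlex q w) :
    (fun i : Fin (m + 1) => radial q w i.succ.succ) ⬝ᵥ
      (reducedMatrix (edgeTan q r) (edgeCot q r)).mulVec
        (fun i => chordDefect q i.succ.succ) = 0 := by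
  rw [dotProduct_reducedMatrix_mulVec, ← chordDefect_eq_extendByZero hX,
    ← radial_eq_extendByZero hw, edgeForm_chordDefect hq hX, sum_edgeTan_mul_radial hq hX hw]

theorem det_reducedMatrix_ne_zero (hr : r ≠ 0) (hq : ∀ k, inner ℝ (q k) (q k) = r ^ 2)
    (hX : ∀ k, cross (q k) (q (k + 1)) ≠ 0) :
    (reducedMatrix (edgeTan q r) (edgeCot q r)).det ≠ 0 := by
  rw [← sign_ne_zero, sign_det_reducedMatrix hr hq hX]
  refine mul_ne_zero (pow_ne_zero _ (by decide)) (Finset.prod_ne_zero_iff.2 fun k _ => ?_)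
  exact sign_ne_zero.2 (hX k)

/-- The constraints are independent at a non-collinear inscribed polygon. The radial parts of the
tangent vectors lie in the kernel of a nonzero functional on `ℝ^(m + 1)`, which bounds the dimension
of the tangent space by `m`, and rank-nullity does the rest. -/
theorem surjective_fderiv_constraintMap (hr : r ≠ 0) (hq : ∀ k, inner ℝ (q k) (q k) = r ^ 2)
    (hX : ∀ k, cross (q k) (q (k + 1)) ≠ 0) (hcol : ¬ Collinear ℝ (Set.range q))
    {P : Fin (m + 3) → Plane}
    (hflex : ∀ w, fderiv ℝ constraintMap P w = 0 → IsInfinitesimalFlex q w) :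
    Function.Surjective (fderiv ℝ constraintMap P) ∧
      Module.finrank ℝ (fderiv ℝ constraintMap P).ker = m := by
  set M := reducedMatrix (edgeTan q r) (edgeCot q r) with hM
  set v : Fin (m + 1) → ℝ := fun i => chordDefect q i.succ.succ with hv
  let g : (Fin (m + 1) → ℝ) →ₗ[ℝ] ℝ := dotProductBilin ℝ ℝ (M.mulVec v)
  have hg : g ≠ 0 := by
    intro hg
    have h1 : M.mulVec v = 0 := dotProduct_self_eq_zero.1 (LinearMap.congr_fun hg (M.mulVec v))
    exact chordDefect_restrict_ne_zero hX hcol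
      (Matrix.eq_zero_of_mulVec_eq_zero (det_reducedMatrix_ne_zero hr hq hX) h1)
  let ρ : (fderiv ℝ (constraintMap (m := m)) P).ker →ₗ[ℝ] LinearMap.ker g :=
    { toFun := fun w => ⟨fun i => radial q w.1 i.succ.succ, by
        have := radial_dotProduct_eq_zero hq hX (hflex w.1 w.2)
        rw [dotProduct_comm] at this
        exact this⟩
      map_add' := fun w w' => by
        ext i; exact congrFun (radial_add q w.1 w'.1) _
      map_smul' := fun s w => by
        ext i; exact congrFun (radial_smul q w.1 s) _ }
  have hρ : Function.Injective ρ := by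
    rw [injective_iff_map_eq_zero]
    intro w hw
    have hf := hflex w.1 w.2
    refine Subtype.ext (eq_zero_of_radial_eq_zero hr hq hX hf ?_)
    have h1 : (fun i : Fin (m + 1) => radial q w.1 i.succ.succ) = 0 := congrArg Subtype.val hw
    rw [radial_eq_extendByZero hf, h1, eq_comm]
    exact eq_extendByZero rfl rfl
  have h1 := LinearMap.finrank_le_finrank_of_injective hρ
  have h2 := Module.Dual.finrank_ker_add_one_of_ne_zero hg
  have h3 := (fderiv ℝ (constraintMap (m := m)) P).toLinearMap.finrank_range_add_finrank_ker
  have h4 : Module.finrank ℝ (Fin (m + 3) → Plane) = 2 * (m + 3) := by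
    simp [Module.finrank_pi_fintype, mul_comm]
  have h5 : Module.finrank ℝ ((Plane × Plane) × (Fin (m + 2) → ℝ)) = m + 6 := by
    simp; ring
  have h6 := Submodule.finrank_le (fderiv ℝ (constraintMap (m := m)) P).range
  rw [Module.finrank_fin_fun] at h2
  rw [h5] at h6
  rw [h4] at h3
  have h7 : Module.finrank ℝ (fderiv ℝ (constraintMap (m := m)) P).range = m + 6 := by omega
  refine ⟨?_, by omega⟩
  exact LinearMap.range_eq_top.1 (Submodule.eq_top_of_finrank_eq (h7.trans h5.symm))

end Inscribed

/-! ### The Hessian determinant -/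

/-- In radial coordinates the Hessian matrix is `(2 r²)⁻¹ • Bᵀ M B`, where `M` is the reduced
tridiagonal matrix and `B` the derivative of the parametrization. -/
theorem sign_det_hessianMatrix {m : ℕ} {l : Fin (m + 3) → ℝ} {P q : Fin (m + 3) → Plane}
    {O : Plane} {r : ℝ} (hPq : P = fun k => q k + O) (hr : 0 < r)
    (hq : ∀ k, inner ℝ (q k) (q k) = r ^ 2) (hX : ∀ k, cross (q k) (q (k + 1)) ≠ 0)
    (hcol : ¬ Collinear ℝ (Set.range q))
    (hflex : ∀ w, fderiv ℝ constraintMap P w = 0 → IsInfinitesimalFlex q w)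
    {U : Set (Fin m → ℝ)} {φ : (Fin m → ℝ) → (Fin (m + 3) → Plane)} {u : Fin m → ℝ}
    (h : IsLocalParametrization (moduliSpace l) P U φ u)
    (hM : moduliSpace l = {p | constraintMap p = constraintMap P}) :
    SignType.sign (hessianMatrix (fun v => signedArea (φ v)) u).det
      = SignType.sign (reducedMatrix (edgeTan q r) (edgeCot q r)).det
        * SignType.sign (∑ k, edgeTan q r k) := by
  obtain ⟨L, hL⟩ := exists_clm_lagrangianForm (edgeCot q r)
  have hcrit : L (φ u) = 0 := by
    ext w
    rw [h.map_eq, hL, hPq, lagrangianForm_add_const, lagrangianForm_eq_zero hq hX]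
    rfl
  have hf : ∀ v ∈ U, signedArea (φ v) = L (φ v) (φ v) + ∑ k, edgeCot q r k / 4 * l k ^ 2 := by
    intro v hv
    obtain ⟨W, -, hW⟩ := h.image_eq
    have hd := (hW.subset ⟨v, hv, rfl⟩).1.1
    rw [hL, lagrangianForm_self]
    simp only [real_inner_self_eq_norm_sq, ← dist_eq_norm, dist_comm (φ v (_ + 1)), hd]
    ring
  have hw : ∀ x, IsInfinitesimalFlex q (fderiv ℝ φ u x) := fun x =>
    hflex _ ((hM ▸ h).fderiv_apply_eq_zero (contDiff_constraintMap.differentiable (by simp) P) x)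
  set M := reducedMatrix (edgeTan q r) (edgeCot q r) with hMdef
  let B : Matrix (Fin (m + 1)) (Fin m) ℝ :=
    Matrix.of fun i j => radial q (fderiv ℝ φ u (Pi.single j 1)) i.succ.succ
  let v : Fin (m + 1) → ℝ := fun i => chordDefect q i.succ.succ
  have hBx : ∀ x : Fin m → ℝ, B.mulVec x = fun i => radial q (fderiv ℝ φ u x) i.succ.succ := by
    intro x
    let R : (Fin m → ℝ) →ₗ[ℝ] (Fin (m + 1) → ℝ) :=
      { toFun := fun x i => radial q (fderiv ℝ φ u x) i.succ.succ
        map_add' := fun x y => by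
          ext i; rw [map_add, radial_add]; rfl
        map_smul' := fun s x => by
          ext i; rw [map_smul, radial_smul]; rfl }
    have hR : B = LinearMap.toMatrix' R := by
      ext i j
      rw [LinearMap.toMatrix'_apply]
      simp [B, R, Pi.single]
    rw [hR, LinearMap.toMatrix'_mulVec]
    rfl
  have hH : hessianMatrix (fun v => signedArea (φ v)) u
      = (2 * r ^ 2)⁻¹ • (B.transpose * M * B) := by
    ext i j
    have h1 : (B.transpose * M * B) i j = edgeForm (edgeTan q r) (edgeCot q r)
        (radial q (fderiv ℝ φ u (Pi.single i 1))) (radial q (fderiv ℝ φ u (Pi.single j 1))) := by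
      rw [edgeForm_comm, radial_eq_extendByZero (hw (Pi.single i 1)),
        radial_eq_extendByZero (hw (Pi.single j 1)), ← dotProduct_reducedMatrix_mulVec,
        Matrix.mul_assoc]
      rfl
    rw [Matrix.smul_apply, h1, hessianMatrix, Matrix.of_apply,
      fderiv_fderiv_comp_quadratic L (fun x y => by rw [hL, hL, lagrangianForm_comm]) h.isOpen
        h.contDiffOn h.mem hcrit _ hf, hL, smul_eq_mul]
    have h2 := sq_mul_lagrangianForm hr.ne' hq hX (hw (Pi.single i 1)) (hw (Pi.single j 1))
    field_simp
    linear_combination 4 * h2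
  have hB : ∀ x, B.mulVec x = 0 → x = 0 := by
    intro x hx
    have h1 : fderiv ℝ φ u x = 0 := by
      refine eq_zero_of_radial_eq_zero hr.ne' hq hX (hw x) ?_
      rw [radial_eq_extendByZero (hw x), ← hBx, hx, eq_comm]
      exact eq_extendByZero rfl rfl
    exact (map_eq_zero_iff _ (h.injective_fderiv u h.mem)).1 h1
  have hBv : B.transpose.mulVec (M.mulVec v) = 0 := by
    ext j
    exact radial_dotProduct_eq_zero hq hX (hw (Pi.single j 1))
  have hvv : v ⬝ᵥ M.mulVec v = 4 * ∑ k, edgeTan q r k := by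
    rw [dotProduct_reducedMatrix_mulVec, ← chordDefect_eq_extendByZero hX,
      edgeForm_chordDefect_self hq hX]
  rw [hH, Matrix.det_smul, sign_mul, sign_pos (by positivity), one_mul,
    sign_det_transpose_mul_mul M (det_reducedMatrix_ne_zero hr.ne' hq hX) B hB v
      (chordDefect_restrict_ne_zero hX hcol) hBv, hvv, sign_mul,
    sign_pos (by norm_num : (0 : ℝ) < 4), one_mul]

end PolygonalLinkage

end

open PolygonalLinkage in
theorem theorem3p4 {n : ℕ} [NeZero n] (hn : 3 ≤ n)
    (l : Fin n → ℝ) (hl : ∀ i, 0 < l i)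
    (P : Fin n → PolygonalLinkage.Plane) (hP : P ∈ PolygonalLinkage.moduliSpace l)
    (O : PolygonalLinkage.Plane) (r : ℝ) (hcyc : PolygonalLinkage.IsInscribed P O r)
    (hcentral : ¬ PolygonalLinkage.IsCentral P O)
    (hcol : ¬ Collinear ℝ (Set.range P)) :
    (∃ (U : Set (Fin (n - 3) → ℝ)) (φ : (Fin (n - 3) → ℝ) → (Fin n → PolygonalLinkage.Plane))
        (u : Fin (n - 3) → ℝ),
      PolygonalLinkage.IsLocalParametrization (PolygonalLinkage.moduliSpace l) P U φ u) ∧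
    ∀ (U : Set (Fin (n - 3) → ℝ)) (φ : (Fin (n - 3) → ℝ) → (Fin n → PolygonalLinkage.Plane))
        (u : Fin (n - 3) → ℝ),
      PolygonalLinkage.IsLocalParametrization (PolygonalLinkage.moduliSpace l) P U φ u →
      SignType.sign
          (PolygonalLinkage.hessianMatrix (fun v => PolygonalLinkage.signedArea (φ v)) u).det =
        - SignType.sign (PolygonalLinkage.delta P O)
          * (-1) ^ PolygonalLinkage.numPositive P O := by
  obtain ⟨m, rfl⟩ : ∃ m, n = m + 3 := ⟨n - 3, by omega⟩
  change (∃ (U : Set (Fin m → ℝ)) (φ : (Fin m → ℝ) → (Fin (m + 3) → PolygonalLinkage.Plane))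
        (u : Fin m → ℝ),
      PolygonalLinkage.IsLocalParametrization (PolygonalLinkage.moduliSpace l) P U φ u) ∧
    ∀ (U : Set (Fin m → ℝ)) (φ : (Fin m → ℝ) → (Fin (m + 3) → PolygonalLinkage.Plane))
        (u : Fin m → ℝ),
      PolygonalLinkage.IsLocalParametrization (PolygonalLinkage.moduliSpace l) P U φ u →
      SignType.sign
          (PolygonalLinkage.hessianMatrix (fun v => PolygonalLinkage.signedArea (φ v)) u).det =
        - SignType.sign (PolygonalLinkage.delta P O)
          * (-1) ^ PolygonalLinkage.numPositive P O
  set q : Fin (m + 3) → Plane := fun k => P k - O with hqdef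
  have hPq : P = fun k => q k + O := funext fun k => (sub_add_cancel _ _).symm
  have hqn : ∀ k, ‖q k‖ = r := fun k => by rw [← hcyc k, dist_eq_norm]
  have hq : ∀ k, inner ℝ (q k) (q k) = r ^ 2 := fun k => by
    rw [real_inner_self_eq_norm_sq, hqn]
  have hne : ∀ k, q k ≠ q (k + 1) := fun k hk => by
    have h1 := hP.1 k
    rw [sub_left_injective hk, dist_self] at h1
    exact (hl k).ne h1
  have hX : ∀ k, cross (q k) (q (k + 1)) ≠ 0 := fun k =>
    cross_ne_zero_of_inner_self_eq (hq k) (hq (k + 1)) (hne k) fun h => by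
      refine hcentral ⟨k, 1 / 2, 1 / 2, by norm_num, by norm_num, by norm_num, ?_⟩
      rw [hPq]
      have : q (k + 1) = - q k := (neg_eq_of_add_eq_zero_right h).symm
      simp only [this]
      module
  have hr : 0 < r := by
    refine (hqn 0 ▸ norm_nonneg (q 0)).lt_of_ne' fun h => hX 0 ?_
    rw [norm_eq_zero.1 ((hqn 0).trans h)]
    simp [cross]
  have hcolq : ¬ Collinear ℝ (Set.range q) := fun h => hcol <| by
    obtain ⟨p₀, v, hv⟩ := (collinear_iff_exists_forall_eq_smul_vadd _).1 h
    refine (collinear_iff_exists_forall_eq_smul_vadd _).2 ⟨p₀ + O, v, ?_⟩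
    rintro _ ⟨k, rfl⟩
    obtain ⟨s, hs⟩ := hv (q k) ⟨k, rfl⟩
    refine ⟨s, ?_⟩
    rw [congrFun hPq k, hs, vadd_eq_add, vadd_eq_add, add_assoc]
  have hflex : ∀ w, fderiv ℝ constraintMap P w = 0 → IsInfinitesimalFlex q w := fun w hw => by
    have h := isInfinitesimalFlex_of_fderiv_constraintMap_eq_zero hw
    refine ⟨h.zero, h.one, fun k => ?_⟩
    rw [hqdef]
    simpa only [sub_sub_sub_cancel_right] using h.inner_eq_zero k
  have hM := moduliSpace_eq_constraintMap_levelSet hl hP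
  refine ⟨?_, fun U φ u h => ?_⟩
  · rw [hM]
    obtain ⟨hsurj, hker⟩ := surjective_fderiv_constraintMap hr.ne' hq hX hcolq hflex
    exact exists_isLocalParametrization_levelSet contDiff_constraintMap P hsurj hker
  · have horient : ∀ k, orient P O k = SignType.sign (cross (q k) (q (k + 1))) := fun k => by
      rw [orient]
      congr 1
      simp only [hqdef, cross, PiLp.sub_apply]
      ring
    have hdelta : delta P O = ∑ k, edgeTan q r k := by
      refine Finset.sum_congr rfl fun k _ => ?_
      rw [horient]
      exact sign_cross_mul_tan_half_angle hr (hqn k) (hqn (k + 1)) (hX k)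
    rw [sign_det_hessianMatrix hPq hr hq hX hcolq hflex h hM, sign_det_reducedMatrix hr.ne' hq hX,
      prod_sign_eq fun k => sign_ne_zero.2 (hX k), hdelta, numPositive]
    simp only [horient]
    rw [neg_mul, neg_mul, mul_comm]
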